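/- Formulae are built from countably many variables and the constant $\mathbf{1}$ by the binary connectives $\backslash$ and $\wedge$. A sequent $A_1,\dots,A_n\vdash B$ consists of a finite (possibly empty) sequence of formulae and a formula. The calculus $\mathbf{L}^{+\varepsilon}(\backslash,\wedge,\mathbf{1})$ (without cut) has the axioms $A\vdash A$ and $A,\mathbf{1}\vdash A$ and the following rules, where $A,B,C,G$ are arbitrary formulae and $\Gamma,\Pi,\Delta$ arbitrary finite sequences of formulae: - from $\Pi\vdash A$ and $\Gamma,B,\Delta\vdash C$ infer $\Gamma,\Pi,A\backslash B,\Delta\vdash C$; from $A,\Pi\vdash B$ infer $\Pi\vdash A\backslash B$; - from $\Gamma,A\vdash C$, and likewise from $\Gamma,B\vdash C$, infer $\Gamma,A\wedge B\vdash C$; from $\Pi\vdash A$ and $\Pi\vdash B$ infer $\Pi\vdash A\wedge B$; - from $\Gamma,A,\mathbf{1}\wedge G,\Delta\vdash C$ infer $\Gamma,\mathbf{1}\wedge G,A,\Delta\vdash C$, and conversely; from $\Gamma,\mathbf{1}\wedge G,\mathbf{1}\wedge G,\Delta\vdash C$ infer $\Gamma,\mathbf{1}\wedge G,\Delta\vdash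 C$. An $\mathrm{L}\varepsilon$-model over a non-empty (possibly infinite) alphabet $\Sigma$ assigns to each formula $A$ a language $w(A)\subseteq\Sigma^*$, arbitrarily on variables and with $w(A\backslash B)=\{u\in\Sigma^*\mid vu\in w(B)\text{ for all }v\in w(A)\}$, $w(A\wedge B)=w(A)\cap w(B)$ and $w(\mathbf{1})=\{\varepsilon\}$, where $\varepsilon$ is the empty word. The sequent $A_1,\dots,A_n\vdash B$ is true in the model if $w(A_1)\cdots w(A_n)\subseteq w(B)$ (for $n=0$: if $\varepsilon\in w(B)$). Theorem. Let $\mathcal{L}$ be any set of sequents (the sequents derivable in some logic) that contains every sequent derivable in $\mathbf{L}^{+\varepsilon}(\backslash,\wedge,\mathbf{1})$ and all of whose elements are true in all $\mathrm{L}\varepsilon$-models. Then $\mathcal{L}$ is undecidable. Moreover, the complete theory, i.e. the set of all sequents true in all $\mathrm{L}\varepsilon$-models, is $\Sigma^0_1$-hard: every recursively enumerable set of natural numbers is many-one reducible to it by a computable function. -/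

import Mathlib

namespace LambekUnit

/-! ## Formulae and sequents in the language of left division, additive conjunction and the unit -/

/-- Formulae built from countably many variables and the unit constant by `\` and `∧`. -/
inductive Formula : Type
  | var (n : ℕ) : Formula
  | one : Formula
  | ldiv (A B : Formula) : Formula
  | conj (A B : Formula) : Formula

/-- A sequent `A₁, …, Aₙ ⊢ B` (`n = 0` is allowed) is the pair `([A₁, …, Aₙ], B)`. -/
abbrev Sequent : Type := List Formula × Formula

namespace Formula

/-- The Gödel number of a formula. -/
def toNat : Formula → ℕ
  | one => 0
  | var n => 3 * n + 1
  | ldiv A B => 3 * Nat.pair A.toNat B.toNat + 2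
  | conj A B => 3 * Nat.pair A.toNat B.toNat + 3

/-- The formula with a given Gödel number. -/
def ofNat : ℕ → Formula
  | 0 => one
  | n + 1 =>
    have h1 : (n / 3).unpair.1 < n + 1 :=
      Nat.lt_succ_of_le ((Nat.unpair_left_le _).trans (Nat.div_le_self _ _))
    have h2 : (n / 3).unpair.2 < n + 1 :=
      Nat.lt_succ_of_le ((Nat.unpair_right_le _).trans (Nat.div_le_self _ _))
    if n % 3 = 0 then var (n / 3)
    else if n % 3 = 1 then ldiv (ofNat (n / 3).unpair.1) (ofNat (n / 3).unpair.2)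
    else conj (ofNat (n / 3).unpair.1) (ofNat (n / 3).unpair.2)

theorem ofNat_toNat (A : Formula) : ofNat A.toNat = A := by
  induction A with
  | var n =>
    have h1 : 3 * n % 3 = 0 := by omega
    have h2 : 3 * n / 3 = n := by omega
    simp [toNat, ofNat, h1, h2]
  | one => simp [toNat, ofNat]
  | ldiv A B hA hB =>
    have h1 : (3 * Nat.pair A.toNat B.toNat + 1) % 3 = 1 := by omega
    have h2 : (3 * Nat.pair A.toNat B.toNat + 1) / 3 = Nat.pair A.toNat B.toNat := by omega
    simp [toNat, ofNat, h1, h2, hA, hB]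
  | conj A B hA hB =>
    have h1 : (3 * Nat.pair A.toNat B.toNat + 2) % 3 = 2 := by omega
    have h2 : (3 * Nat.pair A.toNat B.toNat + 2) / 3 = Nat.pair A.toNat B.toNat := by omega
    simp [toNat, ofNat, h1, h2, hA, hB]

theorem toNat_ofNat (n : ℕ) : (ofNat n).toNat = n := by
  induction n using Nat.strong_induction_on with
  | _ n ih =>
    cases n with
    | zero => simp [toNat, ofNat]
    | succ n =>
      have h1 := ih (n / 3).unpair.1
        (Nat.lt_succ_of_le ((Nat.unpair_left_le _).trans (Nat.div_le_self _ _)))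
      have h2 := ih (n / 3).unpair.2
        (Nat.lt_succ_of_le ((Nat.unpair_right_le _).trans (Nat.div_le_self _ _)))
      rw [ofNat]
      split_ifs with h h'
      · simp only [toNat]; omega
      · simp only [toNat, h1, h2, Nat.pair_unpair]; omega
      · simp only [toNat, h1, h2, Nat.pair_unpair]; omega

/-- Gödel numbering is a bijection between formulae and natural numbers. -/
def equivNat : Formula ≃ ℕ := ⟨toNat, ofNat, ofNat_toNat, toNat_ofNat⟩

/-- Computability of sets of formulae (and, via Mathlib's instances for lists and pairs, of
sequents) refers to this Gödel numbering. -/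
instance : Denumerable Formula := Denumerable.mk' equivNat

end Formula

open Formula

/-! ## The calculus -/

/-- `Derivable Γ C`: the sequent `Γ ⊢ C` is derivable in the (cut-free) calculus
`L^{+ε}(\, ∧, 1)`. -/
inductive Derivable : List Formula → Formula → Prop
  /-- `A ⊢ A` -/
  | id (A : Formula) : Derivable [A] A
  /-- `A, 1 ⊢ A` -/
  | unit (A : Formula) : Derivable [A, one] A
  /-- from `Π ⊢ A` and `Γ, B, Δ ⊢ C` infer `Γ, Π, A \ B, Δ ⊢ C` -/
  | ldivL (Γ P Δ : List Formula) (A B C : Formula) :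
      Derivable P A → Derivable (Γ ++ [B] ++ Δ) C →
      Derivable (Γ ++ P ++ [ldiv A B] ++ Δ) C
  /-- from `A, Π ⊢ B` infer `Π ⊢ A \ B` -/
  | ldivR (P : List Formula) (A B : Formula) :
      Derivable (A :: P) B → Derivable P (ldiv A B)
  /-- from `Γ, A ⊢ C` infer `Γ, A ∧ B ⊢ C` -/
  | andLl (Γ : List Formula) (A B C : Formula) :
      Derivable (Γ ++ [A]) C → Derivable (Γ ++ [conj A B]) C
  /-- from `Γ, B ⊢ C` infer `Γ, A ∧ B ⊢ C` -/
  | andLr (Γ : List Formula) (A B C : Formula) :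
      Derivable (Γ ++ [B]) C → Derivable (Γ ++ [conj A B]) C
  /-- from `Π ⊢ A` and `Π ⊢ B` infer `Π ⊢ A ∧ B` -/
  | andR (P : List Formula) (A B : Formula) :
      Derivable P A → Derivable P B → Derivable P (conj A B)
  /-- from `Γ, A, 1 ∧ G, Δ ⊢ C` infer `Γ, 1 ∧ G, A, Δ ⊢ C` -/
  | commL (Γ Δ : List Formula) (G A C : Formula) :
      Derivable (Γ ++ [A, conj one G] ++ Δ) C → Derivable (Γ ++ [conj one G, A] ++ Δ) C
  /-- from `Γ, 1 ∧ G, A, Δ ⊢ C` infer `Γ, A, 1 ∧ G, Δ ⊢ C` -/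
  | commR (Γ Δ : List Formula) (G A C : Formula) :
      Derivable (Γ ++ [conj one G, A] ++ Δ) C → Derivable (Γ ++ [A, conj one G] ++ Δ) C
  /-- from `Γ, 1 ∧ G, 1 ∧ G, Δ ⊢ C` infer `Γ, 1 ∧ G, Δ ⊢ C` -/
  | doubling (Γ Δ : List Formula) (G C : Formula) :
      Derivable (Γ ++ [conj one G, conj one G] ++ Δ) C → Derivable (Γ ++ [conj one G] ++ Δ) C

/-! ## Language models with the empty word -/

/-- Left division of languages: `A \ B = {u ∈ Σ* | ∀ v ∈ A, v u ∈ B}`. -/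
def langLdiv {α : Type} (A B : Language α) : Language α :=
  {u : List α | ∀ v ∈ A, v ++ u ∈ B}

/-- The value of a formula in the language model in which the variable `n` is interpreted by the
language `w n` over the alphabet `α`; the unit is interpreted by `{ε}`. -/
def interp {α : Type} (w : ℕ → Language α) : Formula → Language α
  | var n => w n
  | one => 1
  | ldiv A B => langLdiv (interp w A) (interp w B)
  | conj A B => interp w A ⊓ interp w B

/-- `A₁, …, Aₙ ⊢ B` is true in a model if `w(A₁) ⋯ w(Aₙ) ⊆ w(B)`; for `n = 0` the product is
`{ε}`, so the condition says `ε ∈ w(B)`. -/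
def TrueIn {α : Type} (w : ℕ → Language α) (s : Sequent) : Prop :=
  (s.1.map (interp w)).prod ≤ interp w s.2

/-- The complete theory of language models: the set of all sequents that are true in all language
models over all (non-empty, possibly infinite) alphabets. -/
def languageTheory : Set Sequent :=
  {s | ∀ (α : Type) [Nonempty α] (w : ℕ → Language α), TrueIn w s}

/-- A logic (a set of sequents, those derivable in it) includes the calculus if it contains all
sequents derivable in the calculus. -/
def IncludesCalculus (L : Set Sequent) : Prop :=
  ∀ (Γ : List Formula) (C : Formula), Derivable Γ C → (Γ, C) ∈ L

/-- A logic is sound with respect to language models if all its sequents are true in all of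
them. -/
def LanguageSound (L : Set Sequent) : Prop := L ⊆ languageTheory

/-- `P` is `Σ⁰₁`-hard: every recursively enumerable set of natural numbers is many-one reducible
to `P` by a computable function. -/
def SigmaOneHard {β : Type} [Primcodable β] (P : β → Prop) : Prop :=
  ∀ Q : ℕ → Prop, REPred Q → ManyOneReducible Q P

end LambekUnit

namespace LambekUnit

open Formula

/-! ## Soundness of the calculus -/

section Soundness

variable {α : Type}

/-! Halting of Turing machines is reduced to both ends of the interval at once. For a recursively
enumerable `Q`, `exists_reduction` gives a computable map sending `Q` to derivable sequents and its
complement to sequents refuted in some language model. The map therefore reduces `Q` to every logic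
in between, and a noncomputable `Q` gives undecidability.

The intermediate device is a machine working on the two ends of a word. Each instruction becomes a
formula, and the program becomes `1 ∧ ⋀ l`, whose exchange and doubling rules make it a reusable,
movable resource. Accepting runs turn into derivations (`Accepts.derivable`). Conversely, let a
letter denote itself and a state denote the words accepted from it: then `ε` lies in every
instruction formula, so truth of the sequent in this single model already yields an accepting run
(`accepts_of_mem_languageTheory`). No cut elimination or proof analysis is needed.

Appending on the right is not an instruction, since only left division is present; it is replaced by
appending on the left followed by a full rotation of the word. With this, the device simulates
finite Turing machines (`accepts_fetch_iff_eval_dom`). -/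

theorem Language.eq_zero_or_one_of_le_one {X : Language α} (h : X ≤ 1) : X = 0 ∨ X = 1 := by
  have h' : ∀ u ∈ X, u = [] := fun u hu => (Language.mem_one u).1 (h hu)
  by_cases h0 : ([] : List α) ∈ X
  · right
    refine le_antisymm h fun u hu => ?_
    rw [(Language.mem_one u).1 hu]
    exact h0
  · left
    ext u
    refine ⟨fun hu => (h0 (h' u hu ▸ hu)).elim, fun hu => (Language.notMem_zero u hu).elim⟩

/-- `0` and `1` are central and idempotent, which is why exchange and doubling for `1 ∧ G` are
sound. -/
theorem interp_conj_one_eq (w : ℕ → Language α) (G : Formula) :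
    interp w (conj one G) = 0 ∨ interp w (conj one G) = 1 :=
  Language.eq_zero_or_one_of_le_one (show interp w one ⊓ interp w G ≤ 1 from inf_le_left)

theorem mul_langLdiv_le (X Y : Language α) : X * langLdiv X Y ≤ Y := by
  rintro _ ⟨v, hv, u, hu, rfl⟩
  exact hu v hv

theorem le_langLdiv {X Y Z : Language α} (h : X * Y ≤ Z) : Y ≤ langLdiv X Z :=
  fun u hu v hv => h ⟨v, hv, u, hu, rfl⟩

theorem Derivable.trueIn {Γ : List Formula} {C : Formula} (h : Derivable Γ C)
    (w : ℕ → Language α) : (Γ.map (interp w)).prod ≤ interp w C := by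
  induction h with
  | id A => simp
  | unit A => simp [interp]
  | ldivL Γ P Δ A B C _ _ ih₁ ih₂ =>
    simp only [List.map_append, List.prod_append, List.map_cons, List.map_nil, List.prod_cons,
      List.prod_nil, mul_one] at ih₂ ⊢
    refine le_trans ?_ ih₂
    have h₁ : (P.map (interp w)).prod * interp w (ldiv A B) ≤ interp w B :=
      (mul_le_mul_left ih₁ _).trans (mul_langLdiv_le _ _)
    calc _ = (Γ.map (interp w)).prod * ((P.map (interp w)).prod * interp w (ldiv A B))
          * (Δ.map (interp w)).prod := by simp only [mul_assoc]
      _ ≤ _ := mul_le_mul_left (mul_le_mul_right h₁ _) _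
  | ldivR P A B _ ih => exact le_langLdiv (by simpa using ih)
  | andLl Γ A B C _ ih =>
    simp only [List.map_append, List.prod_append, List.map_cons, List.map_nil, List.prod_cons,
      List.prod_nil, mul_one] at ih ⊢
    exact (mul_le_mul_right (show interp w A ⊓ interp w B ≤ interp w A from inf_le_left) _).trans ih
  | andLr Γ A B C _ ih =>
    simp only [List.map_append, List.prod_append, List.map_cons, List.map_nil, List.prod_cons,
      List.prod_nil, mul_one] at ih ⊢
    exact (mul_le_mul_right (show interp w A ⊓ interp w B ≤ interp w B from inf_le_right) _).trans ih
  | andR P A B _ _ ih₁ ih₂ => exact le_inf ih₁ ih₂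
  | commL Γ Δ G A C _ ih =>
    rcases interp_conj_one_eq w G with h | h
    · simp [h]
    · simpa [h] using ih
  | commR Γ Δ G A C _ ih =>
    rcases interp_conj_one_eq w G with h | h
    · simp [h]
    · simpa [h] using ih
  | doubling Γ Δ G C _ ih =>
    rcases interp_conj_one_eq w G with h | h
    · simp [h]
    · simpa [h] using ih

/-- Language models are sound for the calculus. -/
theorem Derivable.mem_languageTheory {Γ : List Formula} {C : Formula} (h : Derivable Γ C) :
    (Γ, C) ∈ languageTheory :=
  fun _ _ w => h.trueIn w

end Soundness

/-! ## Reusable hypotheses -/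

/-- The conjunction of a list of formulae. -/
def bigConj : List Formula → Formula
  | [] => one
  | A :: l => conj A (bigConj l)

theorem Derivable.bigConj_left {Γ : List Formula} {A C : Formula} {l : List Formula}
    (hA : A ∈ l) (h : Derivable (Γ ++ [A]) C) : Derivable (Γ ++ [bigConj l]) C := by
  induction l with
  | nil => simp at hA
  | cons B l ih =>
    rcases List.mem_cons.1 hA with rfl | hA
    · exact .andLl _ _ _ _ h
    · exact .andLr _ _ _ _ (ih hA)

theorem nil_mem_interp_bigConj {α : Type} {w : ℕ → Language α} {l : List Formula}
    (h : ∀ A ∈ l, [] ∈ interp w A) : [] ∈ interp w (bigConj l) := by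
  induction l with
  | nil => exact Language.nil_mem_one
  | cons B l ih =>
    exact ⟨h B (by simp), ih fun A hA => h A (by simp [hA])⟩

/-- The formula `1 ∧ ⋀ l`, which makes the members of `l` available as often as desired. -/
def bang (l : List Formula) : Formula := conj one (bigConj l)

/-- Doubling supplies a spare copy, which is narrowed to the chosen conjunct. The copy must stand
last because the left rules for `∧` act only there. -/
theorem Derivable.bang_use {Γ : List Formula} {A C : Formula} {l : List Formula}
    (hA : A ∈ l) (h : Derivable (Γ ++ [bang l] ++ [A]) C) : Derivable (Γ ++ [bang l]) C := by
  have h₁ : Derivable (Γ ++ [bang l, bang l] ++ []) C := by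
    simpa [bang] using Derivable.andLr _ one _ _ (h.bigConj_left hA)
  simpa [bang] using Derivable.doubling Γ [] _ _ h₁

/-- The rule for `\` on the left, applied to the last formula of the antecedent. -/
theorem Derivable.ldiv_last {Γ P : List Formula} {A B C : Formula}
    (h₁ : Derivable P A) (h₂ : Derivable (Γ ++ [B]) C) : Derivable (Γ ++ P ++ [ldiv A B]) C := by
  simpa using Derivable.ldivL Γ P [] A B C h₁ (by simpa using h₂)

theorem Derivable.ldiv_self {P : List Formula} {A B : Formula}
    (h : Derivable P A) : Derivable (P ++ [ldiv A B]) B := by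
  simpa using Derivable.ldiv_last (Γ := []) h (Derivable.id B)

/-! ## Rewriting systems acting on both ends of a word -/

/-- An instruction of a nondeterministic machine which operates on the two ends of a word over the
alphabet `A` with states in `Q`: jump, append or remove a letter on the left, remove a letter on
the right, or accept the empty word. -/
inductive Instr (Q A : Type) : Type
  | goto (q q' : Q)
  | lpush (q : Q) (a : A) (q' : Q)
  | lpop (q : Q) (a : A) (q' : Q)
  | rpop (q : Q) (a : A) (q' : Q)
  | acc (q : Q)

/-- The program `R` has an accepting run from the state `q` and the word `u`. -/
inductive Accepts {Q A : Type} (R : List (Instr Q A)) : Q → List A → Prop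
  | goto {q q' u} : Instr.goto q q' ∈ R → Accepts R q' u → Accepts R q u
  | lpush {q a q' u} : Instr.lpush q a q' ∈ R → Accepts R q' (a :: u) → Accepts R q u
  | lpop {q a q' u} : Instr.lpop q a q' ∈ R → Accepts R q' u → Accepts R q (a :: u)
  | rpop {q a q' u} : Instr.rpop q a q' ∈ R → Accepts R q' u → Accepts R q (u ++ [a])
  | acc {q} : Instr.acc q ∈ R → Accepts R q []

section Encoding

variable {Q A : Type} [Encodable Q] [Encodable A]

/-- The variable naming a state. -/
def stateVar (_A : Type) (q : Q) : Formula := var (2 * Encodable.encode q)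

/-- The variable naming a letter. -/
def letterVar (a : A) : Formula := var (2 * Encodable.encode a + 1)

/-- The formula expressing an instruction. -/
def Instr.formula : Instr Q A → Formula
  | goto q q' => ldiv (stateVar A q') (stateVar A q)
  | lpush q a q' => ldiv (ldiv (letterVar a) (stateVar A q')) (stateVar A q)
  | lpop q a q' => ldiv (stateVar A q') (ldiv (letterVar a) (stateVar A q))
  | rpop q a q' => ldiv (letterVar a) (ldiv (stateVar A q') (stateVar A q))
  | acc q => stateVar A q

/-- The reusable formula expressing a program. -/
def programFormula (R : List (Instr Q A)) : Formula := bang (R.map Instr.formula)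

/-- The antecedent expressing a word in the presence of a program. -/
def antecedent (R : List (Instr Q A)) (u : List A) : List Formula :=
  u.map letterVar ++ [programFormula R]

theorem Accepts.derivable {R : List (Instr Q A)} {q : Q} {u : List A} (h : Accepts R q u) :
    Derivable (antecedent R u) (stateVar A q) := by
  induction h with
  | goto hr _ ih =>
    exact .bang_use (List.mem_map_of_mem hr) ih.ldiv_self
  | lpush hr _ ih =>
    exact .bang_use (List.mem_map_of_mem hr) (Derivable.ldivR _ _ _ ih).ldiv_self
  | @lpop q a q' u hr _ ih =>
    exact .bang_use (List.mem_map_of_mem hr)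
      (Derivable.ldiv_last (Γ := [letterVar a]) ih (Derivable.id (letterVar a)).ldiv_self)
  | @rpop q a q' u hr _ ih =>
    refine .bang_use (List.mem_map_of_mem hr) ?_
    have h := Derivable.ldiv_last (Γ := antecedent R u) (Derivable.id (letterVar a))
      (ih.ldiv_self (B := stateVar A q))
    -- The letter to be removed must stand next to its divisor, so the program formula is exchanged
    -- with it.
    have := Derivable.commR (u.map letterVar)
      [ldiv (letterVar a) (ldiv (stateVar A q') (stateVar A q))] _ (letterVar a) _
      (by simpa [antecedent, programFormula, bang] using h)
    simpa [antecedent, programFormula, bang, Instr.formula] using this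
  | @acc q hr =>
    refine .bang_use (List.mem_map_of_mem hr) ?_
    -- The leftover program formula is discarded by narrowing it to `1` and using the axiom `A, 1 ⊢
    -- A`.
    have h : Derivable ([stateVar A q] ++ [programFormula R]) (stateVar A q) :=
      .andLl _ _ _ _ (Derivable.unit _)
    exact Derivable.commL [] [] _ _ _ h

/-- The model in which a letter denotes itself and a state the set of words accepted from it. -/
def acceptModel (R : List (Instr Q A)) (n : ℕ) : Language A :=
  {u | (∃ q : Q, 2 * Encodable.encode q = n ∧ Accepts R q u) ∨
    ∃ a : A, 2 * Encodable.encode a + 1 = n ∧ u = [a]}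

theorem mem_interp_stateVar {R : List (Instr Q A)} {q : Q} {u : List A} :
    u ∈ interp (acceptModel R) (stateVar A q) ↔ Accepts R q u := by
  constructor
  · rintro (⟨q', hq, h⟩ | ⟨a, ha, -⟩)
    · rwa [← Encodable.encode_injective (Nat.eq_of_mul_eq_mul_left two_pos hq)]
    · omega
  · exact fun h => Or.inl ⟨q, rfl, h⟩

theorem mem_interp_letterVar {R : List (Instr Q A)} {a : A} {u : List A} :
    u ∈ interp (acceptModel R) (letterVar a) ↔ u = [a] := by
  constructor
  · rintro (⟨q', hq, -⟩ | ⟨a', ha, h⟩)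
    · omega
    · rwa [← Encodable.encode_injective
        (Nat.eq_of_mul_eq_mul_left two_pos (Nat.add_right_cancel ha))]
  · exact fun h => Or.inr ⟨a, rfl, h⟩

/-- With `ε` as the tested word, the divisions unfold to exactly the closure property of `Accepts`
under the instruction. -/
theorem nil_mem_interp_formula {R : List (Instr Q A)} {r : Instr Q A} (hr : r ∈ R) :
    [] ∈ interp (acceptModel R) r.formula := by
  cases r with
  | goto q q' =>
    intro v hv
    rw [List.append_nil]
    exact mem_interp_stateVar.2 (.goto hr (mem_interp_stateVar.1 hv))
  | lpush q a q' =>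
    intro v hv
    rw [List.append_nil]
    exact mem_interp_stateVar.2
      (.lpush hr (mem_interp_stateVar.1 (hv _ (mem_interp_letterVar.2 rfl))))
  | lpop q a q' =>
    intro v hv x hx
    rw [mem_interp_letterVar.1 hx]
    simpa using mem_interp_stateVar.2 (.lpop hr (mem_interp_stateVar.1 hv))
  | rpop q a q' =>
    intro v hv x hx
    rw [mem_interp_letterVar.1 hv]
    simpa using mem_interp_stateVar.2 (.rpop hr (mem_interp_stateVar.1 hx))
  | acc q => exact mem_interp_stateVar.2 (.acc hr)

theorem mem_interp_prod_letterVar (R : List (Instr Q A)) (u : List A) :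
    u ∈ ((u.map letterVar).map (interp (acceptModel R))).prod := by
  induction u with
  | nil => exact Language.nil_mem_one
  | cons a u ih =>
    rw [List.map_cons, List.map_cons, List.prod_cons]
    exact Language.append_mem_mul (a := [a]) (mem_interp_letterVar.2 rfl) ih

theorem accepts_of_mem_languageTheory [Nonempty A] {R : List (Instr Q A)} {q : Q} {u : List A}
    (h : (antecedent R u, stateVar A q) ∈ languageTheory) : Accepts R q u := by
  have h₁ := h A (acceptModel R)
  refine mem_interp_stateVar.1 (h₁ ?_)
  simp only [antecedent, List.map_append, List.prod_append, List.map_cons, List.map_nil,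
    List.prod_cons, List.prod_nil, mul_one]
  have h₂ : [] ∈ interp (acceptModel R) (programFormula R) := by
    refine ⟨Language.nil_mem_one, nil_mem_interp_bigConj fun F hF => ?_⟩
    obtain ⟨r, hr, rfl⟩ := List.mem_map.1 hF
    exact nil_mem_interp_formula hr
  have h₃ := Language.append_mem_mul (mem_interp_prod_letterVar R u) h₂
  rwa [List.append_nil] at h₃

end Encoding

/-! ## Simulation of Turing machines -/

section TuringMachine

open Turing

/-- Letters of the simulating machine: tape symbols, the separator of the two halves of the tape,
and a marker for a full rotation of the word. -/
inductive Letter (Γ : Type) : Type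
  | sym (g : Γ)
  | bottom
  | mark
  deriving Fintype

/-- States of the simulating machine. In `run q a` the Turing machine is in state `q` with the
symbol `a` under its head; in `fetch q` the head symbol has to be taken from the right end;
`push x q b` appends `x` on the right and then continues with `run q b`. -/
inductive SimState (Λ Γ : Type) : Type
  | run (q : Λ) (a : Γ)
  | fetch (q : Λ)
  | restore (q : Λ) (a : Γ)
  | push (x : Letter Γ) (q : Λ) (b : Γ)
  | marked (x : Letter Γ) (q : Λ) (b : Γ)
  | rotate (q : Λ) (b : Γ)
  | turn (c : Letter Γ) (q : Λ) (b : Γ)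
  deriving Fintype

deriving instance Fintype for Instr

open SimState Letter

variable {Λ Γ : Type}

/-- The word for the two halves of a tape. -/
def tapeWord (L R : List Γ) : List (Letter Γ) :=
  L.map sym ++ bottom :: (R.map sym).reverse

/-- The right half is stored reversed, so the two cells adjacent to the head are the two ends of the
word. -/
theorem tapeWord_cons_right (L R : List Γ) (g : Γ) :
    tapeWord L (g :: R) = tapeWord L R ++ [sym g] := by
  simp [tapeWord]

theorem tapeWord_cons_left (L R : List Γ) (g : Γ) :
    tapeWord (g :: L) R = sym g :: tapeWord L R := by
  simp [tapeWord]

theorem mark_notMem_tapeWord (L R : List Γ) : mark ∉ tapeWord L R := by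
  simp [tapeWord]

variable [Inhabited Λ] [Inhabited Γ]

/-- The instructions simulating a Turing machine. -/
inductive SimInstr (M : TM0.Machine Γ Λ) : Instr (SimState Λ Γ) (Letter Γ) → Prop
  | write {q a q' b} : M q a = some (q', TM0.Stmt.write b) →
      SimInstr M (.goto (run q a) (run q' b))
  | right {q a q'} : M q a = some (q', TM0.Stmt.move Dir.right) →
      SimInstr M (.lpush (run q a) (sym a) (fetch q'))
  | fetch_sym (q g) : SimInstr M (.rpop (fetch q) (sym g) (run q g))
  | fetch_bottom (q) : SimInstr M (.rpop (fetch q) bottom (push bottom q default))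
  | left_sym {q a q'} (g) : M q a = some (q', TM0.Stmt.move Dir.left) →
      SimInstr M (.lpop (run q a) (sym g) (push (sym a) q' g))
  | left_bottom {q a q'} : M q a = some (q', TM0.Stmt.move Dir.left) →
      SimInstr M (.lpop (run q a) bottom (restore q' a))
  | restore (q a) : SimInstr M (.lpush (restore q a) bottom (push (sym a) q default))
  | push (x q b) : SimInstr M (.lpush (push x q b) mark (marked x q b))
  | marked (x q b) : SimInstr M (.lpush (marked x q b) x (rotate q b))
  | rotate {c} (q b) : c ≠ mark → SimInstr M (.rpop (rotate q b) c (turn c q b))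
  | turn (c q b) : SimInstr M (.lpush (turn c q b) c (rotate q b))
  | rotate_mark (q b) : SimInstr M (.rpop (rotate q b) mark (run q b))
  | clear {q a} (c) : M q a = none → SimInstr M (.rpop (run q a) c (run q a))
  | halt {q a} : M q a = none → SimInstr M (.acc (run q a))

/-- The program simulating a Turing machine. -/
noncomputable def simProgram [Finite Λ] [Finite Γ] (M : TM0.Machine Γ Λ) :
    List (Instr (SimState Λ Γ) (Letter Γ)) :=
  letI := Fintype.ofFinite Λ
  letI := Fintype.ofFinite Γ
  (Set.toFinite {r | SimInstr M r}).toFinset.toList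

theorem mem_simProgram [Finite Λ] [Finite Γ] {M : TM0.Machine Γ Λ}
    {r : Instr (SimState Λ Γ) (Letter Γ)} : r ∈ simProgram M ↔ SimInstr M r := by
  simp [simProgram]

/-- The machine halts when started in the given configuration. -/
def Halts (M : TM0.Machine Γ Λ) (c : TM0.Cfg Γ Λ) : Prop :=
  (StateTransition.eval (TM0.step M) c).Dom

theorem halts_of_step {M : TM0.Machine Γ Λ} {c c' : TM0.Cfg Γ Λ} (h : TM0.step M c = some c')
    (h' : Halts M c') : Halts M c := by
  unfold Halts
  rwa [StateTransition.reaches_eval (Relation.ReflTransGen.single h)]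

theorem halts_of_step_eq_none {M : TM0.Machine Γ Λ} {c : TM0.Cfg Γ Λ}
    (h : TM0.step M c = none) : Halts M c :=
  Part.dom_iff_mem.2 ⟨c, StateTransition.mem_eval.2 ⟨.refl, h⟩⟩

/-- What acceptance from `run q a` means. -/
def RunMeaning (M : TM0.Machine Γ Λ) (q : Λ) (a : Γ) (u : List (Letter Γ)) : Prop :=
  ∀ L R, u = tapeWord L R → Halts M ⟨q, ⟨a, ListBlank.mk L, ListBlank.mk R⟩⟩

/-- What acceptance from `rotate q b` means. -/
def RotateMeaning (M : TM0.Machine Γ Λ) (q : Λ) (b : Γ) (u : List (Letter Γ)) : Prop :=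
  ∀ x y, mark ∉ x → mark ∉ y → u = x ++ mark :: y → RunMeaning M q b (y ++ x)

/-- What acceptance from a state of the simulating machine means. -/
def Meaning (M : TM0.Machine Γ Λ) : SimState Λ Γ → List (Letter Γ) → Prop
  | run q a, u => RunMeaning M q a u
  | fetch q, u => ∀ L R, u = tapeWord L R →
      Halts M ⟨q, Tape.mk' (ListBlank.mk L) (ListBlank.mk R)⟩
  | restore q a, u => RotateMeaning M q default (sym a :: mark :: bottom :: u)
  | push x q b, u => RotateMeaning M q b (x :: mark :: u)
  | marked x q b, u => RotateMeaning M q b (x :: u)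
  | rotate q b, u => RotateMeaning M q b u
  | turn c q b, u => RotateMeaning M q b (c :: u)

/-- This is the simulated append on the right: rotating `x :: mark :: u` until `mark` reaches the
right end and is removed leaves `u ++ [x]`. -/
theorem RotateMeaning.push {M : TM0.Machine Γ Λ} {q : Λ} {b : Γ} {x : Letter Γ}
    {u : List (Letter Γ)} (h : RotateMeaning M q b (x :: mark :: u)) (hx : mark ≠ x)
    (hu : mark ∉ u) : RunMeaning M q b (u ++ [x]) :=
  h [x] u (by simpa using hx) hu rfl

theorem step_eq {M : TM0.Machine Γ Λ} {q q' : Λ} {a : Γ} {s : TM0.Stmt Γ}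
    (h : M q a = some (q', s)) (L R : ListBlank Γ) :
    TM0.step M ⟨q, ⟨a, L, R⟩⟩ = some ⟨q', match s with
      | .move d => Tape.move d ⟨a, L, R⟩
      | .write b => ⟨b, L, R⟩⟩ := by
  simp only [TM0.step, h]
  cases s <;> rfl

theorem append_singleton_inj {α : Type} {u v : List α} {a b : α} (h : u ++ [a] = v ++ [b]) :
    u = v ∧ a = b := by
  simpa using List.append_inj' h rfl

/-- Induction on the run. Words of the wrong shape satisfy the meaning vacuously, so stray runs are
harmless; on words of the right shape the end letters determine which case of the simulation
applies. -/
theorem meaning_of_accepts [Finite Λ] [Finite Γ] {M : TM0.Machine Γ Λ} {q : SimState Λ Γ}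
    {u : List (Letter Γ)} (h : Accepts (simProgram M) q u) : Meaning M q u := by
  induction h with
  | goto hr _ ih =>
    cases mem_simProgram.1 hr with
    | write h =>
      intro L R hu
      exact halts_of_step (step_eq h _ _) (ih L R hu)
  | lpush hr _ ih =>
    cases mem_simProgram.1 hr with
    | right h =>
      intro L R hu
      subst hu
      refine halts_of_step (step_eq h _ _) ?_
      have := ih (_ :: L) R (tapeWord_cons_left L R _).symm
      simpa [Tape.move, Tape.mk'] using this
    | restore => exact ih
    | push => exact ih
    | marked => exact ih
    | turn => exact ih
  | @lpop _ _ _ v hr _ ih =>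
    cases mem_simProgram.1 hr with
    | left_sym g h =>
      rintro (_ | ⟨g', L⟩) R hu
      · simp [tapeWord] at hu
      · rw [tapeWord_cons_left] at hu
        obtain ⟨⟨⟩, rfl⟩ := List.cons.inj hu
        refine halts_of_step (step_eq h _ _) ?_
        have := RotateMeaning.push ih (by simp) (mark_notMem_tapeWord L R) L (_ :: R)
          (tapeWord_cons_right L R _).symm
        simpa [Tape.move] using this
    | left_bottom h =>
      rintro (_ | ⟨g', L⟩) R hu
      · refine halts_of_step (step_eq h _ _) ?_
        have := RotateMeaning.push ih (by simp) (hu ▸ mark_notMem_tapeWord [] R) [] (_ :: R)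
          (by rw [tapeWord_cons_right, hu])
        simpa [Tape.move] using this
      · simp [tapeWord] at hu
  | @rpop _ _ _ v hr _ ih =>
    cases mem_simProgram.1 hr with
    | fetch_sym q g =>
      rintro L (_ | ⟨g', R⟩) hu
      · have := (append_singleton_inj (v := L.map sym) (b := bottom) hu).2
        cases this
      · rw [tapeWord_cons_right] at hu
        obtain ⟨rfl, ⟨⟩⟩ := append_singleton_inj hu
        simpa [Tape.mk'] using ih L R rfl
    | fetch_bottom q =>
      rintro L (_ | ⟨g', R⟩) hu
      · have hv := (append_singleton_inj (v := L.map sym) (b := bottom) hu).1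
        have := RotateMeaning.push ih (by simp) (by simp [hv]) L [] hu
        simpa [Tape.mk'] using this
      · rw [tapeWord_cons_right] at hu
        cases (append_singleton_inj hu).2
    | rotate q b hc =>
      intro x y hx hy hu
      rcases List.eq_nil_or_concat y with rfl | ⟨y, c, rfl⟩
      · exact (hc (append_singleton_inj hu).2).elim
      · rw [List.concat_eq_append] at hu hy ⊢
        obtain ⟨rfl, rfl⟩ := append_singleton_inj (v := x ++ mark :: y) (by simpa using hu)
        have := ih (_ :: x) y (by simpa [hx] using Ne.symm hc) (fun h => hy (by simp [h])) rfl
        simpa using this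
    | rotate_mark q b =>
      intro x y hx hy hu
      rcases List.eq_nil_or_concat y with rfl | ⟨y, c, rfl⟩
      · obtain ⟨rfl, -⟩ := append_singleton_inj hu
        exact ih
      · rw [List.concat_eq_append] at hu hy
        have := (append_singleton_inj (v := x ++ mark :: y) (by simpa using hu)).2
        exact (hy (by simp [this])).elim
    | clear c h =>
      exact fun L R _ => halts_of_step_eq_none (by simp [TM0.step, h])
  | acc hr =>
    cases mem_simProgram.1 hr with
    | halt h => exact fun L R _ => halts_of_step_eq_none (by simp [TM0.step, h])

section Completeness

variable [Finite Λ] [Finite Γ] {M : TM0.Machine Γ Λ}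

/-- Each turn carries the last letter of `y` to the front of `x`, hence the induction from the right
with `x` generalized. -/
theorem accepts_rotate {q : Λ} {b : Γ} {x y : List (Letter Γ)} (hy : mark ∉ y)
    (h : Accepts (simProgram M) (run q b) (y ++ x)) :
    Accepts (simProgram M) (rotate q b) (x ++ mark :: y) := by
  induction y using List.reverseRecOn generalizing x with
  | nil => exact .rpop (mem_simProgram.2 (.rotate_mark q b)) h
  | append_singleton y c ih =>
    have hc : c ≠ mark := by rintro rfl; simp at hy
    have := ih (x := c :: x) (fun h => hy (by simp [h])) (by simpa using h)
    simpa using Accepts.rpop (mem_simProgram.2 (.rotate q b hc))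
      (.lpush (mem_simProgram.2 (.turn c q b)) this)

theorem accepts_push {q : Λ} {b : Γ} {x : Letter Γ} {u : List (Letter Γ)} (hu : mark ∉ u)
    (h : Accepts (simProgram M) (run q b) (u ++ [x])) :
    Accepts (simProgram M) (push x q b) u :=
  .lpush (mem_simProgram.2 (.push x q b)) <| .lpush (mem_simProgram.2 (.marked x q b)) <|
    accepts_rotate (x := [x]) hu h

theorem accepts_clear {q : Λ} {a : Γ} (h : M q a = none) (u : List (Letter Γ)) :
    Accepts (simProgram M) (run q a) u := by
  induction u using List.reverseRecOn with
  | nil => exact .acc (mem_simProgram.2 (.halt h))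
  | append_singleton u c ih => exact .rpop (mem_simProgram.2 (.clear c h)) ih

/-- A `ListBlank` fixes its list only up to trailing blanks, so the hypothesis covers every
representative of the tail. -/
theorem accepts_fetch {q : Λ} (L R : List Γ)
    (h : ∀ R', ListBlank.mk R' = (ListBlank.mk R).tail →
      Accepts (simProgram M) (run q (ListBlank.mk R).head) (tapeWord L R')) :
    Accepts (simProgram M) (fetch q) (tapeWord L R) := by
  cases R with
  | nil =>
    have h₁ : tapeWord L [] = L.map sym ++ [bottom] := rfl
    rw [h₁]
    refine .rpop (mem_simProgram.2 (.fetch_bottom q)) (accepts_push (by simp) ?_)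
    exact h [] (by simp)
  | cons g R =>
    rw [tapeWord_cons_right]
    exact .rpop (mem_simProgram.2 (.fetch_sym q g)) (h R (by simp))

theorem accepts_of_halts {c : TM0.Cfg Γ Λ} (h : Halts M c) (L R : List Γ)
    (hL : c.Tape.left = ListBlank.mk L) (hR : c.Tape.right = ListBlank.mk R) :
    Accepts (simProgram M) (run c.q c.Tape.head) (tapeWord L R) := by
  obtain ⟨c', hc'⟩ := Part.dom_iff_mem.1 h
  clear h
  revert L R
  refine StateTransition.evalInduction (C := fun c => ∀ L R : List Γ,
    c.Tape.left = ListBlank.mk L → c.Tape.right = ListBlank.mk R →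
      Accepts (simProgram M) (run c.q c.Tape.head) (tapeWord L R)) hc' ?_
  · intro c _ ih L R hL hR
    obtain ⟨q, a, TL, TR⟩ := c
    subst hL hR
    rcases hM : M q a with _ | ⟨q', d | b⟩
    · exact accepts_clear hM _
    · cases d with
      | left =>
        have ih := ih _ (step_eq hM _ _)
        cases L with
        | nil =>
          have := ih [] (a :: R) (by simp [Tape.move]) (by simp [Tape.move])
          rw [tapeWord_cons_right] at this
          exact .lpop (mem_simProgram.2 (.left_bottom hM)) <|
            .lpush (mem_simProgram.2 (.restore q' a)) <|
              accepts_push (mark_notMem_tapeWord [] R) this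
        | cons g L =>
          have := ih L (a :: R) (by simp [Tape.move]) (by simp [Tape.move])
          rw [tapeWord_cons_right] at this
          rw [tapeWord_cons_left]
          exact .lpop (mem_simProgram.2 (.left_sym g hM)) <|
            accepts_push (mark_notMem_tapeWord L R) this
      | right =>
        refine .lpush (mem_simProgram.2 (.right hM)) ?_
        rw [← tapeWord_cons_left]
        refine accepts_fetch _ _ fun R' hR' => ?_
        exact ih _ (step_eq hM _ _) (a :: L) R' (by simp [Tape.move]) (by simp [Tape.move, hR'])
    · exact .goto (mem_simProgram.2 (.write hM)) (ih _ (step_eq hM _ _) L R rfl rfl)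

/-- The simulation is faithful on input words. -/
theorem accepts_fetch_iff_eval_dom (l : List Γ) :
    Accepts (simProgram M) (fetch default) (tapeWord [] l) ↔ (TM0.eval M l).Dom := by
  have h₁ : (TM0.eval M l).Dom ↔ Halts M (TM0.init l) := Iff.rfl
  rw [h₁]
  constructor
  · exact fun h => meaning_of_accepts h [] l rfl
  · exact fun h => accepts_fetch _ _ fun R' hR' => accepts_of_halts h [] R' rfl hR'.symm

end Completeness

end TuringMachine

/-! ## Finite Turing machines for recursively enumerable sets -/

section Machines

open Turing

/-- The restriction of a Turing machine to a supporting set of states. -/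
theorem exists_machine_on_support {Λ Γ : Type} [Inhabited Λ] [Inhabited Γ]
    (M : TM0.Machine Γ Λ) {S : Set Λ} (hS : TM0.Supports M S) :
    ∃ (_ : Inhabited S) (M' : TM0.Machine Γ S), ∀ l, (TM0.eval M' l).Dom ↔ (TM0.eval M l).Dom := by
  classical
  let i : Inhabited S := ⟨⟨default, hS.1⟩⟩
  let e : PointedMap Γ Γ := ⟨id, rfl⟩
  -- The value outside `S` is arbitrary, as a supported machine started in `default` never leaves
  -- `S`.
  let g : PointedMap Λ S := ⟨fun q => if h : q ∈ S then ⟨q, h⟩ else default, dif_pos hS.1⟩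
  refine ⟨i, M.map e e g Subtype.val, fun l => ?_⟩
  refine StateTransition.tr_eval_dom
    (TM0.Machine.map_respects M e e g Subtype.val hS (fun _ => rfl) fun q hq => ?_)
    ⟨hS.1, ?_⟩
  · exact congrArg Subtype.val (dif_pos hq)
  · rw [TM0.map_init]
    exact congrArg _ (List.map_id l)

theorem exists_code_of_rePred {Q : ℕ → Prop} (hQ : REPred Q) :
    ∃ c : ToPartrec.Code, ∀ n, (c.eval [n]).Dom ↔ Q n := by
  have h : Partrec fun n => (Part.assert (Q n) fun _ => Part.some ()).map fun _ => (0 : ℕ) :=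
    Partrec.map hQ (Computable.const 0).to₂
  obtain ⟨c, hc⟩ := ToPartrec.Code.exists_code (Nat.Partrec'.part_iff₁.2 h)
  refine ⟨c, fun n => ?_⟩
  have := hc ⟨[n], rfl⟩
  rw [show c.eval [n] = _ from this]
  simp [Part.assert, List.Vector.head]

instance : Finite PartrecToTM2.K' :=
  Finite.of_surjective
    (fun i : Fin 4 => ![PartrecToTM2.K'.main, .rev, .aux, .stack] i)
    (by rintro (_ | _ | _ | _) <;> [exact ⟨0, rfl⟩; exact ⟨1, rfl⟩; exact ⟨2, rfl⟩; exact ⟨3, rfl⟩])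

/-- The tape alphabet of the Turing machines obtained from partial recursive functions. -/
abbrev TapeSymbol : Type := TM2to1.Γ' PartrecToTM2.K' fun _ => PartrecToTM2.Γ'

instance : Finite TapeSymbol :=
  inferInstanceAs (Finite (Bool × (PartrecToTM2.K' → Option PartrecToTM2.Γ')))

/-- The input word for a natural number. -/
def inputWord (n : ℕ) : List TapeSymbol :=
  TM2to1.trInit PartrecToTM2.K'.main (PartrecToTM2.trList [n])

theorem exists_finite_machine_of_rePred {Q : ℕ → Prop} (hQ : REPred Q) :
    ∃ (Λ : Type) (_ : Finite Λ) (_ : Inhabited Λ) (M : TM0.Machine TapeSymbol Λ),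
      ∀ n, (TM0.eval M (inputWord n)).Dom ↔ Q n := by
  obtain ⟨c, hc⟩ := exists_code_of_rePred hQ
  -- The initial state is the default one, so the program `c` enters through this instance.
  let i : Inhabited PartrecToTM2.Λ' := ⟨PartrecToTM2.trNormal c .halt⟩
  have h2 := PartrecToTM2.tr_supports c .halt
  have h1 := TM2to1.tr_supports _ h2
  have h0 := TM1to0.tr_supports _ h1
  obtain ⟨j, M, hM⟩ := exists_machine_on_support _ h0
  refine ⟨_, Finite.of_fintype _, j, M, fun n => ?_⟩
  rw [hM, TM1to0.tr_eval]
  refine (TM2to1.tr_eval_dom _ _ _).trans (Iff.trans ?_ (hc n))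
  have h : TM2.init PartrecToTM2.K'.main (PartrecToTM2.trList [n]) = PartrecToTM2.init c [n] := by
    simp only [TM2.init, PartrecToTM2.init]
    congr 1
    funext k
    cases k <;> rfl
  have := congrArg Part.Dom (PartrecToTM2.tr_eval c [n])
  rw [← h] at this
  exact iff_of_eq this

end Machines

/-! ## Computability of the input -/

section Input

open Turing

/-- Binary successor on little-endian bit lists. -/
def incBits (l : List Bool) : List Bool :=
  List.rec [true] (fun b l ih => bif b then false :: ih else true :: l) l

/-- The little-endian binary expansion of a number, obtained by counting. -/
def binary (n : ℕ) : List Bool := Nat.rec [] (fun _ l => incBits l) n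

theorem primrec_incBits : Primrec incBits :=
  Primrec.list_rec Primrec.id (Primrec.const [true])
    (h := fun (_ : List Bool) (p : Bool × List Bool × List Bool) =>
      bif p.1 then false :: p.2.2 else true :: p.2.1)
    (Primrec.cond (Primrec.fst.comp Primrec.snd)
      (Primrec.list_cons.comp (Primrec.const false)
        (Primrec.snd.comp (Primrec.snd.comp Primrec.snd)))
      (Primrec.list_cons.comp (Primrec.const true)
        (Primrec.fst.comp (Primrec.snd.comp Primrec.snd)))).to₂

theorem primrec_binary : Primrec binary :=
  Primrec.nat_rec₁ [] (primrec_incBits.comp Primrec.snd).to₂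

/-- The stack symbol of a binary digit. -/
def bitSymbol (b : Bool) : PartrecToTM2.Γ' := bif b then .bit1 else .bit0

theorem trPosNum_succ {p : PosNum} {l : List Bool}
    (h : PartrecToTM2.trPosNum p = l.map bitSymbol) :
    PartrecToTM2.trPosNum p.succ = (incBits l).map bitSymbol := by
  induction p generalizing l with
  | one =>
    rcases l with _ | ⟨_ | _, _ | ⟨b, l⟩⟩ <;>
      simp [PartrecToTM2.trPosNum, bitSymbol, incBits, PosNum.succ] at h ⊢
  | bit1 p ih =>
    rcases l with _ | ⟨_ | _, l⟩ <;>
      simp [PartrecToTM2.trPosNum, bitSymbol, incBits, PosNum.succ] at h ⊢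
    simpa [incBits, bitSymbol] using ih h
  | bit0 p ih =>
    rcases l with _ | ⟨_ | _, l⟩ <;>
      simp [PartrecToTM2.trPosNum, bitSymbol, incBits, PosNum.succ] at h ⊢
    exact h

/-- `trNat` goes through `Num`; counting with `incBits` gives the same digits by a visibly primitive
recursive function. -/
theorem trNat_eq_map_binary (n : ℕ) : PartrecToTM2.trNat n = (binary n).map bitSymbol := by
  induction n with
  | zero => simp [binary]
  | succ n ih =>
    have h₁ : ((n + 1 : ℕ) : Num) = (n : Num).succ := by
      rw [Nat.cast_succ, Num.add_one]
    have h₂ : binary (n + 1) = incBits (binary n) := rfl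
    rw [PartrecToTM2.trNat, h₁, h₂]
    rw [PartrecToTM2.trNat] at ih
    generalize (n : Num) = m at ih ⊢
    rcases m with _ | p
    · have : binary n = [] := by simpa [PartrecToTM2.trNum] using ih.symm
      rw [this]
      rfl
    · exact trPosNum_succ ih

/-- The tape symbol with the stack symbol `a` on the main stack. -/
def mainSymbol (bottom : Bool) (a : PartrecToTM2.Γ') : TapeSymbol :=
  (bottom, Function.update (fun _ => none) PartrecToTM2.K'.main (some a))

/-- The reversals in `trInit` and `tapeWord` cancel, leaving the digits in order between two fixed
letters. -/
theorem tapeWord_inputWord (n : ℕ) :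
    tapeWord [] (inputWord n) =
      [.bottom] ++ (binary n).map (fun b => .sym (mainSymbol false (bitSymbol b))) ++
        [.sym (mainSymbol true .cons)] := by
  have h : (PartrecToTM2.trList [n]).reverse =
      .cons :: ((binary n).map bitSymbol).reverse := by
    simp [trNat_eq_map_binary]
  have h' : inputWord n = mainSymbol true .cons ::
      ((binary n).map bitSymbol).reverse.map (mainSymbol false) := by
    unfold inputWord TM2to1.trInit
    rw [h]
    rfl
  simp [tapeWord, h', Function.comp_def]

end Input

/-! ## Undecidability -/

/-- A recursively enumerable set reduces to every logic between the calculus and the complete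
theory of language models, uniformly in the logic. -/
theorem exists_reduction {Q : ℕ → Prop} (hQ : REPred Q) :
    ∃ f : ℕ → Sequent, Computable f ∧ (∀ n, Q n → Derivable (f n).1 (f n).2) ∧
      ∀ n, f n ∈ languageTheory → Q n := by
  obtain ⟨Λ, _, _, M, hM⟩ := exists_finite_machine_of_rePred hQ
  let := Fintype.ofFinite Λ
  let := Fintype.ofFinite TapeSymbol
  let : Encodable (SimState Λ TapeSymbol) := Fintype.toEncodable _
  let : Encodable (Letter TapeSymbol) := Fintype.toEncodable _
  have : Nonempty (Letter TapeSymbol) := ⟨.bottom⟩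
  have hacc (n : ℕ) := (accepts_fetch_iff_eval_dom (M := M) (inputWord n)).trans (hM n)
  refine ⟨fun n => (antecedent (simProgram M) (tapeWord [] (inputWord n)),
    stateVar (Letter TapeSymbol) (SimState.fetch default : SimState Λ TapeSymbol)), ?_,
    fun n hn => ((hacc n).2 hn).derivable, fun n hn => (hacc n).1
      (accepts_of_mem_languageTheory hn)⟩
  -- The program and the state are fixed, so their encodings enter only as constants; `n` enters
  -- only through its digits.
  refine Primrec.to_comp (Primrec.pair ?_ (Primrec.const _))
  simp only [antecedent, tapeWord_inputWord, List.map_append, List.map_map]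
  exact Primrec.list_append.comp (Primrec.list_append.comp (Primrec.list_append.comp
    (Primrec.const _) (Primrec.list_map primrec_binary
      ((Primrec.dom_finite _).comp Primrec.snd).to₂)) (Primrec.const _)) (Primrec.const _)

theorem exists_rePred_not_computablePred : ∃ Q : ℕ → Prop, REPred Q ∧ ¬ ComputablePred Q := by
  refine ⟨fun n => ((Denumerable.ofNat Nat.Partrec.Code n).eval 0).Dom, ?_, fun h => ?_⟩
  · exact (Nat.Partrec.Code.eval_part.comp (Computable.ofNat _) (Computable.const 0)).dom_re
  · refine ComputablePred.halting_problem 0 (ComputablePred.computable_of_manyOneReducible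
      ⟨Encodable.encode, Computable.encode, fun c => ?_⟩ h)
    simp

end LambekUnit

theorem theorem4 :
    (∀ L : Set LambekUnit.Sequent,
      LambekUnit.IncludesCalculus L → LambekUnit.LanguageSound L →
        ¬ ComputablePred (fun s : LambekUnit.Sequent => s ∈ L)) ∧
    LambekUnit.SigmaOneHard (fun s : LambekUnit.Sequent => s ∈ LambekUnit.languageTheory) := by
  refine ⟨fun L hL hS hc => ?_, fun Q hQ => ?_⟩
  · obtain ⟨Q, hQ, hQc⟩ := LambekUnit.exists_rePred_not_computablePred
    obtain ⟨f, hf, h₁, h₂⟩ := LambekUnit.exists_reduction hQ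
    exact hQc (ComputablePred.computable_of_manyOneReducible
      ⟨f, hf, fun n => ⟨fun h => hL _ _ (h₁ n h), fun h => h₂ n (hS h)⟩⟩ hc)
  · obtain ⟨f, hf, h₁, h₂⟩ := LambekUnit.exists_reduction hQ
    exact ⟨f, hf, fun n => ⟨fun h => (h₁ n h).mem_languageTheory, h₂ n⟩⟩
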